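/- Two base stations (BSs) $i\in\{1,2\}$, each with a storage of capacity $S_{\max}\ge 0$, operate over time steps $t=1,\dots,N$. Let $0\le\alpha\le1$ be the storage efficiency and $0\le\beta\le1$ the transfer efficiency. The net energies $(E_1(t),E_2(t))$ form a real-valued stochastic process with an arbitrary joint distribution $F$. At time $t$ the controls are $w_i(t)\ge0$ (grid energy), $c_i(t)\ge0$ (charge), $d_i(t)\ge0$ (discharge), and $x_{12}(t),x_{21}(t)\ge0$ (transfers), chosen as measurable functions of $E(1),\dots,E(t)$. The storage levels satisfy $s_i(1)=0$, $s_i(t+1)=s_i(t)+\alpha c_i(t)-d_i(t)$, and the following must hold almost surely for $1\le t\le N$: $$0\le s_i(t),\,s_i(t+1)\le S_{\max},\quad d_i(t)\le s_i(t),\quad c_i(t)d_i(t)=0,\quad x_{12}(t)x_{21}(t)=0,$$ $$E_1+w_1-c_1+\alpha d_1-x_{12}+\beta x_{21}\ge0,\qquad E_2+w_2-c_2+\alpha d_2-x_{21}+\beta x_{12}\ge0 .$$ A control policy is optimal if it minimizes $\mathbb E\big[\frac1N\sum_{t=1}^N(w_1(t)+w_2(t))\big]\in[0,\infty]$ among all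 control policies satisfying these constraints. The modified greedy policy (BS 1 in surplus) does the following at every time $t$, regardless of how $\beta$ compares with $\alpha^2$, where $s_i$, $E_i$ are the current values and all controls not mentioned are zero. 1. Set $x_{12}=\min\{E_1,|E_2|/\beta\}$ and $E_2'=E_2+\beta x_{12}$. 2. If $E_2'=0$, set $E_1'=E_1-x_{12}$ and $c_i=\min\{(S_{\max}-s_i)/\alpha,\,E_i'\}$ for $i=1,2$. If now exactly one storage $i$ has level $s_i'=s_i+\alpha c_i$ equal to $S_{\max}$, BS $i$ additionally transfers $y=E_i'-c_i$ to the other BS $j$, and $c_j$ is increased by $\min\{\beta y,(S_{\max}-s_j')/\alpha\}$. The step ends. 3. If $E_2'\ne0$, set $d_2=\min\{|E_2'|/\alpha,s_2\}$ and $E_2''=E_2'+\alpha d_2$. If $E_2''=0$, the step ends. Otherwise set $d_1=\min\{|E_2''|/(\alpha\beta),s_1\}$, increase $x_{12}$ by $\alpha d_1$, set $E_2'''=E_2''+\alpha\beta d_1$, and, if $E_2'''<0$, set $w_2=|E_2'''|$. (For $\alpha=0$ no storage is charged or discharged, and for $\beta=0$ nothing is transferred: the quantities that would involve a division by zero, and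 for $\beta=0$ also $y$, are taken to be $0$.) **Proposition.** If $E_1(t)\ge0$ and $E_2(t)\le0$ for all $1\le t\le N$ almost surely, then the modified greedy policy satisfies all constraints and is optimal. Symmetrically, if $E_2(t)\ge0$ and $E_1(t)\le0$ for all $1\le t\le N$ almost surely, then the policy obtained by swapping the roles of the two BSs is optimal. -/

import Mathlib

open MeasureTheory

/-!
Two base stations (BSs) are indexed by `Fin 2`; time steps are `t = 0, 1, …, N - 1`.
-/

namespace EnergyCoop

/-- The controls of one time step. Here `x i` is the energy sent from BS `i` to the other BS. -/
structure Control where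
  /-- energy drawn from the grid -/
  w : Fin 2 → ℝ
  /-- energy sent to the local storage -/
  c : Fin 2 → ℝ
  /-- energy taken out of the local storage -/
  d : Fin 2 → ℝ
  /-- energy sent to the other BS -/
  x : Fin 2 → ℝ

/-- The other BS. -/
def other (i : Fin 2) : Fin 2 := 1 - i

/-- A net energy profile: `e t i` is the net energy (generation minus demand) of BS `i` at time
`t`. Only the times `t < N` matter below. -/
abbrev Profile : Type := ℕ → Fin 2 → ℝ

/-- A rule that selects the controls at every time along every profile. -/
abbrev Policy : Type := ℕ → Profile → Control

/-- Storage levels after one step with storage inefficiency `α`. -/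
def nextStorage (α : ℝ) (s : Fin 2 → ℝ) (u : Control) : Fin 2 → ℝ :=
  fun i => s i + α * u.c i - u.d i

/-- The storage levels at the beginning of time step `t`; both storages are empty initially. -/
def storage (α : ℝ) (π : Policy) (e : Profile) : ℕ → Fin 2 → ℝ
  | 0 => 0
  | t + 1 => nextStorage α (storage α π e t) (π t e)

/-- The controls `u` are allowed at storage levels `s` and net energies `E`. -/
structure Feasible (α β S : ℝ) (s E : Fin 2 → ℝ) (u : Control) : Prop where
  w_nonneg : ∀ i, 0 ≤ u.w i
  c_nonneg : ∀ i, 0 ≤ u.c i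
  d_nonneg : ∀ i, 0 ≤ u.d i
  x_nonneg : ∀ i, 0 ≤ u.x i
  /-- no simultaneous charging and discharging of one storage -/
  charge_or_discharge : ∀ i, u.c i * u.d i = 0
  /-- energy is transferred in at most one direction -/
  one_way : u.x 0 * u.x 1 = 0
  discharge_le : ∀ i, u.d i ≤ s i
  next_nonneg : ∀ i, 0 ≤ nextStorage α s u i
  next_le : ∀ i, nextStorage α s u i ≤ S
  /-- energy neutralization -/
  neutral : ∀ i, 0 ≤ E i + u.w i - u.c i + α * u.d i - u.x i + β * u.x (other i)

/-- Control policies over `N` steps when the profile has joint distribution `F`: the controls at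
time `t` are measurable functions of the net energies up to time `t`, and all constraints hold
almost surely. -/
structure Admissible (α β S : ℝ) (N : ℕ) (F : Measure Profile) (π : Policy) : Prop where
  measurable_w : ∀ t < N, ∀ i, Measurable fun e => (π t e).w i
  measurable_c : ∀ t < N, ∀ i, Measurable fun e => (π t e).c i
  measurable_d : ∀ t < N, ∀ i, Measurable fun e => (π t e).d i
  measurable_x : ∀ t < N, ∀ i, Measurable fun e => (π t e).x i
  causal : ∀ t < N, ∀ e e' : Profile, (∀ k ≤ t, e k = e' k) → π t e = π t e'
  feasible : ∀ᵐ e ∂F, ∀ t < N, Feasible α β S (storage α π e t) (e t) (π t e)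

/-- The expected average energy drawn from the grid, `𝔼[(1/N) ∑ₜ (w₁(t) + w₂(t))]`, as an element
of `[0, ∞]`. -/
noncomputable def expectedCost (N : ℕ) (F : Measure Profile) (π : Policy) : ENNReal :=
  ∫⁻ e, ENNReal.ofReal
    ((1 / (N : ℝ)) * ∑ t ∈ Finset.range N, ((π t e).w 0 + (π t e).w 1)) ∂F

/-- `π` is a control policy that minimizes the expected average energy drawn from the grid. -/
def IsOptimal (α β S : ℝ) (N : ℕ) (F : Measure Profile) (π : Policy) : Prop :=
  Admissible α β S N F π ∧
    ∀ π', Admissible α β S N F π' → expectedCost N F π ≤ expectedCost N F π'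

/-!
The modified greedy policy. In the boundary cases, `α = 0` means that storages are neither charged
nor discharged, and `β = 0` that nothing is transferred; since `y / 0 = 0` in Lean, the quotients
by `α`, `β` and `α * β` below already give the value `0` that is meant there.
-/

open Classical in
/-- The rule for a step with no deficit: each BS charges its own storage; if then exactly one
storage is full, the BS with the full storage sends its remaining energy to the other BS, which
charges its storage with it as far as possible. -/
noncomputable def surplusRule (α β S : ℝ) (s E : Fin 2 → ℝ) : Control :=
  let c : Fin 2 → ℝ := fun k => min ((S - s k) / α) (E k)
  let s' : Fin 2 → ℝ := fun k => s k + α * c k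
  let share : Fin 2 → Control := fun k =>
    let x := if β = 0 then 0 else E k - c k
    { w := 0
      c := c + Pi.single (other k) (min (β * x) ((S - s' (other k)) / α))
      d := 0
      x := Pi.single k x }
  if s' 0 = S ∧ s' 1 < S then share 0
  else if s' 1 = S ∧ s' 0 < S then share 1
  else { w := 0, c := c, d := 0, x := 0 }

open Classical in
/-- The rule for a step in which BS `i` has a surplus and the other BS `j` has a deficit: first
transfer energy from `i` to `j`, then use the storage of `j`, then the storage of `i`, then the
grid. If the transfer covers the deficit, the remaining energy is treated by `surplusRule`. -/
noncomputable def transferFirstRule (α β S : ℝ) (i : Fin 2) (s E : Fin 2 → ℝ) : Control :=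
  let j := other i
  let x := min (E i) (|E j| / β)
  let E' := E j + β * x
  if E' = 0 then
    let u := surplusRule α β S s (Function.update (Function.update E i (E i - x)) j E')
    { w := u.w, c := u.c, d := u.d, x := u.x + Pi.single i x }
  else
    let dj := min (|E'| / α) (s j)
    let E'' := E' + α * dj
    if E'' = 0 then
      { w := 0, c := 0, d := Pi.single j dj, x := Pi.single i x }
    else
      let di := min (|E''| / (α * β)) (s i)
      let E''' := E'' + α * β * di
      { w := Pi.single j (if E''' < 0 then |E'''| else 0)
        c := 0
        d := Pi.single j dj + Pi.single i di
        x := Pi.single i (x + α * di) }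

/-- The storage levels when `transferFirstRule` is applied at every time step. -/
noncomputable def greedyStorage (α β S : ℝ) (i : Fin 2) (e : Profile) : ℕ → Fin 2 → ℝ
  | 0 => 0
  | t + 1 => nextStorage α (greedyStorage α β S i e t)
      (transferFirstRule α β S i (greedyStorage α β S i e t) (e t))

/-- The modified greedy policy when BS `i` is the one in surplus: apply `transferFirstRule` at
every time step, whatever the values of `α` and `β`. -/
noncomputable def modifiedGreedy (α β S : ℝ) (i : Fin 2) : Policy :=
  fun t e => transferFirstRule α β S i (greedyStorage α β S i e t) (e t)

end EnergyCoop

namespace EnergyCoop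

/-! The greedy policy wins along every single profile, so the distribution plays no role. Let `i` be
the surplus BS and `j` the other. A stored unit is worth `α` at `j` and `α * β` at `i`, so storage
is measured by the potential `deliverable`, V(s) = α (β s_i + s_j). Against any feasible policy, two
inequalities propagate together: W ≤ W' and W + V(s') ≤ W' + V(s), with W, s the grid energy so far
and storage of greedy and W', s' those of the competitor (`transferFirstRule_step`). The sign of D =
β E_i + E_j splits each step. If D ≥ 0, greedy draws nothing and either gains the maximal α² D, or
fills both storages, or α = 0 and V vanishes. If D < 0, greedy wastes nothing, and it draws from the
grid only once V is exhausted; the first inequality then follows from the second because the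
competitor's potential is nonnegative. `Feasible.charge_le` bounds what a competitor can gain. -/

theorem other_ne (i : Fin 2) : other i ≠ i := by
  fin_cases i <;> decide

theorem forall_iff_self_other (i : Fin 2) {p : Fin 2 → Prop} :
    (∀ k, p k) ↔ p i ∧ p (other i) := by
  fin_cases i <;> simp [other, Fin.forall_fin_two, and_comm]

theorem other_other (i : Fin 2) : other (other i) = i := by
  fin_cases i <;> decide

theorem apply_zero_add_apply_one (i : Fin 2) (f : Fin 2 → ℝ) :
    f 0 + f 1 = f i + f (other i) := by
  fin_cases i <;> simp [other, add_comm]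

theorem apply_zero_mul_apply_one (i : Fin 2) (f : Fin 2 → ℝ) :
    f 0 * f 1 = f i * f (other i) := by
  fin_cases i <;> simp [other, mul_comm]

/-- Properties of the largest `m ≤ b` with `a * m ≤ r`, with the convention `r / 0 = 0`. -/
theorem min_div_spec {a r b : ℝ} (ha : 0 ≤ a) (hr : 0 ≤ r) (hb : 0 ≤ b) :
    0 ≤ min (r / a) b ∧ min (r / a) b ≤ b ∧ a * min (r / a) b ≤ r ∧
      (a = 0 ∨ a * min (r / a) b = r ∨ min (r / a) b = b) := by
  refine ⟨le_min (div_nonneg hr ha) hb, min_le_right _ _, ?_, ?_⟩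
  · rcases ha.eq_or_lt with rfl | ha
    · simpa using hr
    · calc a * min (r / a) b ≤ a * (r / a) := by gcongr; exact min_le_left _ _
        _ = r := by field_simp
  · rcases ha.eq_or_lt with rfl | ha
    · exact Or.inl rfl
    · rcases min_choice (r / a) b with h | h
      · right; left; rw [h]; field_simp
      · right; right; exact h

/-! ### Surplus steps. -/

/-- What `surplusRule` does when only BS `i` has a surplus. -/
structure SurplusSpec (α β S : ℝ) (i : Fin 2) (s E : Fin 2 → ℝ) (u : Control) : Prop where
  w_eq : u.w = 0
  d_eq : u.d = 0
  x_other : u.x (other i) = 0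
  x_nonneg : 0 ≤ u.x i
  c_nonneg : ∀ k, 0 ≤ u.c k
  neutral : u.c i + u.x i ≤ E i
  neutral_other : u.c (other i) ≤ E (other i) + β * u.x i
  next_le : ∀ k, s k + α * u.c k ≤ S
  efficient : β * u.c i + u.c (other i) = β * E i + E (other i) ∨
    (∀ k, s k + α * u.c k = S) ∨ α = 0

/-- The two sharing conditions exclude each other, so their order is immaterial and the rule can be
read from the viewpoint of either BS. -/
theorem surplusRule_eq (α β S : ℝ) (i : Fin 2) (s E : Fin 2 → ℝ) :
    surplusRule α β S s E =
      (let c : Fin 2 → ℝ := fun k => min ((S - s k) / α) (E k)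
       let s' : Fin 2 → ℝ := fun k => s k + α * c k
       let share : Fin 2 → Control := fun k =>
         let x := if β = 0 then 0 else E k - c k
         { w := 0
           c := c + Pi.single (other k) (min (β * x) ((S - s' (other k)) / α))
           d := 0
           x := Pi.single k x }
       open Classical in
       if s' i = S ∧ s' (other i) < S then share i
       else if s' (other i) = S ∧ s' i < S then share (other i)
       else { w := 0, c := c, d := 0, x := 0 }) := by
  match i with
  | 0 => rfl
  | 1 =>
    have h : other 1 = 0 := rfl
    simp only [surplusRule, h]
    by_cases h₁ : s 1 + α * min ((S - s 1) / α) (E 1) = S ∧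
        s 0 + α * min ((S - s 0) / α) (E 0) < S
    · rw [if_neg fun h₂ => h₂.2.ne h₁.1, if_pos h₁, if_pos h₁]
    · rw [if_neg h₁, if_neg h₁]

/-- In `efficient` a unit charged at `i` has weight `β`, exactly what arrives when it is sent
instead. Sharing the leftover therefore loses nothing until both storages are full. -/
theorem surplusRule_spec {α β S : ℝ} (hα : 0 ≤ α) (hβ : 0 ≤ β) (i : Fin 2)
    {s E : Fin 2 → ℝ} (hs : ∀ k, s k ≤ S) (hE : 0 ≤ E i) (hE' : E (other i) = 0) :
    SurplusSpec α β S i s E (surplusRule α β S s E) := by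
  rw [surplusRule_eq α β S i]
  have hne := other_ne i
  obtain ⟨a₁, a₂, a₃, a₄⟩ := min_div_spec hα (sub_nonneg.2 (hs i)) hE
  have hj : min ((S - s (other i)) / α) (E (other i)) = 0 := by
    rw [hE']; exact min_eq_right (div_nonneg (sub_nonneg.2 (hs _)) hα)
  have hsj := hs (other i)
  simp only [hj]
  generalize hc : min ((S - s i) / α) (E i) = c at a₁ a₂ a₃ a₄
  split_ifs with h₁ h₂ h₂ h₃
  · subst h₂
    have h0 : min (0 * (0 : ℝ)) ((S - (s (other i) + α * 0)) / α) = 0 := by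
      rw [zero_mul]; exact min_eq_left (div_nonneg (by linarith) hα)
    constructor <;>
      simp only [forall_iff_self_other i, Pi.add_apply, Pi.single_eq_same,
        Pi.single_eq_of_ne hne, Pi.single_eq_of_ne hne.symm, hj, hc, h0]
    -- On `efficient`, `constructor` selects the first alternative, which for `β = 0` reduces to `E
    -- (other i) = 0`.
    all_goals try (constructor <;> linarith)
    all_goals try first | rfl | linarith
  · obtain ⟨b₁, b₂, b₃, b₄⟩ := min_div_spec (b := β * (E i - c)) hα
      (show 0 ≤ S - (s (other i) + α * 0) by linarith) (mul_nonneg hβ (by linarith))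
    rw [min_comm] at b₁ b₂ b₃ b₄
    generalize hm : min (β * (E i - c)) ((S - (s (other i) + α * 0)) / α) = m at b₁ b₂ b₃ b₄
    constructor <;>
      simp only [forall_iff_self_other i, Pi.add_apply, Pi.single_eq_same,
        Pi.single_eq_of_ne hne, Pi.single_eq_of_ne hne.symm, hj, hc]
    all_goals try (constructor <;> linarith)
    all_goals try first | rfl | linarith
    rcases b₄ with h | h | h
    · exact Or.inr (Or.inr h)
    · exact Or.inr (Or.inl ⟨by linarith [h₁.1], by linarith⟩)
    · left; rw [h, hE']; ring
  all_goals
    -- BS `i` does not share here, so a full storage `i` forces the other one to be full as well.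
    have hci : c = E i ∨ (s i + α * c = S ∧ s (other i) = S) ∨ α = 0 := by
      rcases a₄ with h | h | h
      · exact Or.inr (Or.inr h)
      · refine Or.inr (Or.inl ⟨by linarith, ?_⟩)
        by_contra hcon
        exact h₁ ⟨by linarith, by simpa using lt_of_le_of_ne hsj hcon⟩
      · exact Or.inl h
  · have h0 : min (β * (0 : ℝ)) ((S - (s i + α * c)) / α) = 0 := by
      rw [mul_zero]; exact min_eq_left (div_nonneg (by linarith) hα)
    constructor <;>
      simp only [forall_iff_self_other i, Pi.add_apply, Pi.single_eq_same, other_other,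
        Pi.single_eq_of_ne hne, Pi.single_eq_of_ne hne.symm, hj, hc, h0]
    all_goals try (constructor <;> linarith)
    all_goals try first | rfl | linarith
    rcases hci with h | h | h
    · left; rw [h, hE']; ring
    · exact absurd h.1 h₂.2.ne
    · exact Or.inr (Or.inr h)
  · have h0 : min (β * (E (other i) - 0)) ((S - (s i + α * c)) / α) = 0 := by
      rw [hE', sub_zero, mul_zero]; exact min_eq_left (div_nonneg (by linarith) hα)
    constructor <;>
      simp only [forall_iff_self_other i, Pi.add_apply, Pi.single_eq_same, other_other,
        Pi.single_eq_of_ne hne, Pi.single_eq_of_ne hne.symm, hj, hc, h0]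
    all_goals try (constructor <;> linarith)
    all_goals try first | rfl | linarith
    rcases hci with h | h | h
    · left; rw [h, hE']; ring
    · exact absurd h.1 h₂.2.ne
    · exact Or.inr (Or.inr h)
  · constructor <;>
      simp only [forall_iff_self_other i, Pi.zero_apply, hj, hc]
    all_goals try (constructor <;> linarith)
    all_goals try first | rfl | linarith
    rcases hci with h | h | h
    · left; rw [h, hE']
    · exact Or.inr (Or.inl ⟨h.1, by linarith [h.2]⟩)
    · exact Or.inr (Or.inr h)

/-! ### The transfer-first rule in both cases. -/

/-- What `transferFirstRule` does when the surplus does not cover the deficit. -/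
structure DeficitSpec (α β : ℝ) (i : Fin 2) (s E : Fin 2 → ℝ) (u : Control) : Prop where
  w_self : u.w i = 0
  w_other : 0 ≤ u.w (other i)
  c_eq : u.c = 0
  d_nonneg : ∀ k, 0 ≤ u.d k
  d_le : ∀ k, u.d k ≤ s k
  x_other : u.x (other i) = 0
  x_nonneg : 0 ≤ u.x i
  neutral : u.x i ≤ E i + α * u.d i
  neutral_other : E (other i) + u.w (other i) + α * u.d (other i) + β * u.x i = 0
  efficient :
    β * E i + E (other i) + u.w (other i) + α * (β * u.d i + u.d (other i)) = 0
  empty : u.w (other i) = 0 ∨ α = 0 ∨ (u.d (other i) = s (other i) ∧ (β = 0 ∨ u.d i = s i))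

/-- The transfer cancels the deficit exactly and preserves `β * E i + E (other i)`, so the
properties of `surplusRule` carry over. For `β = 0`, `hD` leaves no deficit. -/
theorem transferFirstRule_spec_of_surplus {α β S : ℝ} (hα : 0 ≤ α) (hβ : 0 ≤ β) {i : Fin 2}
    {s E : Fin 2 → ℝ} (hs : ∀ k, s k ≤ S) (hE : 0 ≤ E i) (hE' : E (other i) ≤ 0)
    (hD : 0 ≤ β * E i + E (other i)) :
    SurplusSpec α β S i s E (transferFirstRule α β S i s E) := by
  have hne := other_ne i
  obtain ⟨a₁, a₂, a₃, a₄⟩ := min_div_spec hβ (abs_nonneg (E (other i))) hE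
  have hx : E (other i) + β * min (|E (other i)| / β) (E i) = 0 := by
    rw [abs_of_nonpos hE'] at a₃ a₄ ⊢
    rcases a₄ with h | h | h
    · rw [h] at hD ⊢; linarith
    · linarith
    · rw [h] at a₃ ⊢; linarith
  rw [transferFirstRule]
  dsimp only
  rw [min_comm (E i), if_pos hx]
  generalize min (|E (other i)| / β) (E i) = x at a₁ a₂ a₃ a₄ hx
  rw [hx]
  have h := surplusRule_spec (E := Function.update (Function.update E i (E i - x)) (other i) 0)
    hα hβ i hs (by rw [Function.update_of_ne hne.symm, Function.update_self]; linarith)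
    (Function.update_self ..)
  obtain ⟨h₁, h₂, h₃, h₄, h₅, h₆, h₇, h₈, h₉⟩ := h
  rw [Function.update_of_ne hne.symm, Function.update_self] at h₆
  rw [Function.update_self] at h₇
  rw [Function.update_of_ne hne.symm, Function.update_self, Function.update_self] at h₉
  constructor <;> simp only [Pi.add_apply, Pi.single_eq_same, Pi.single_eq_of_ne hne]
  · exact h₁
  · exact h₂
  · linarith
  · linarith
  · exact h₅
  · linarith
  · linarith
  · exact h₈
  · exact h₉.imp_left fun h => by linarith

theorem transferFirstRule_spec_of_deficit {α β : ℝ} (S : ℝ) (hα : 0 ≤ α) (hβ : 0 ≤ β) {i : Fin 2}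
    {s E : Fin 2 → ℝ} (hs : ∀ k, 0 ≤ s k) (hE : 0 ≤ E i) (hE' : E (other i) ≤ 0)
    (hD : β * E i + E (other i) < 0) :
    DeficitSpec α β i s E (transferFirstRule α β S i s E) := by
  have hne := other_ne i
  have hsi := hs i
  have hsj := hs (other i)
  obtain ⟨a₁, a₂, a₃, a₄⟩ := min_div_spec hβ (abs_nonneg (E (other i))) hE
  rw [transferFirstRule]
  dsimp only
  rw [min_comm (E i)]
  generalize min (|E (other i)| / β) (E i) = x at a₁ a₂ a₃ a₄
  -- For `β = 0` the quotient convention gives `x = 0`, so `x = E i` may fail and only the delivered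
  -- amounts agree.
  have hβx : β * x = β * E i := by
    rw [abs_of_nonpos hE'] at a₄
    rcases a₄ with h | h | h
    · simp [h]
    · have := mul_le_mul_of_nonneg_left a₂ hβ
      linarith
    · rw [h]
  rw [if_neg (by linarith)]
  have hneg : E (other i) + β * x < 0 := by linarith
  obtain ⟨b₁, b₂, b₃, b₄⟩ := min_div_spec hα (abs_nonneg (E (other i) + β * x)) hsj
  generalize min (|E (other i) + β * x| / α) (s (other i)) = d' at b₁ b₂ b₃ b₄
  rw [abs_of_neg hneg] at b₃ b₄
  split_ifs with h₁ h₂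
  · constructor <;>
      simp only [forall_iff_self_other i, Pi.zero_apply, Pi.single_eq_same,
        Pi.single_eq_of_ne hne, Pi.single_eq_of_ne hne.symm]
    all_goals try (constructor <;> linarith)
    all_goals try first | rfl | linarith
    exact Or.inl trivial
  all_goals
    have hneg' : E (other i) + β * x + α * d' < 0 := lt_of_le_of_ne (by linarith) h₁
    obtain ⟨c₁, c₂, c₃, c₄⟩ := min_div_spec (mul_nonneg hα hβ)
      (abs_nonneg (E (other i) + β * x + α * d')) hsi
    generalize min (|E (other i) + β * x + α * d'| / (α * β)) (s i) = d at *
    rw [abs_of_neg hneg'] at c₃ c₄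
    have hb₄ : α = 0 ∨ d' = s (other i) := by
      rcases b₄ with h | h | h
      · exact Or.inl h
      · exact absurd hneg' (by linarith)
      · exact Or.inr h
    have hαd : 0 ≤ α * d := mul_nonneg hα c₁
  · rw [abs_of_neg h₂]
    constructor <;>
      simp only [forall_iff_self_other i, Pi.add_apply, Pi.single_eq_same,
        Pi.single_eq_of_ne hne, Pi.single_eq_of_ne hne.symm]
    all_goals try (constructor <;> linarith)
    all_goals try first | rfl | linarith
    -- A remaining deficit means that neither discharge was limited by demand, hence each was
    -- limited by its storage, up to the cases `α = 0` and `β = 0`.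
    rcases hb₄ with h | h
    · exact Or.inr (Or.inl h)
    · rcases c₄ with h' | h' | h'
      · rcases mul_eq_zero.1 h' with h' | h'
        · exact Or.inr (Or.inl h')
        · exact Or.inr (Or.inr ⟨by linarith, Or.inl h'⟩)
      · exact absurd h₂ (by linarith)
      · exact Or.inr (Or.inr ⟨by linarith, Or.inr (by linarith)⟩)
  · constructor <;>
      simp only [forall_iff_self_other i, Pi.add_apply, Pi.single_eq_same,
        Pi.single_eq_of_ne hne, Pi.single_eq_of_ne hne.symm]
    all_goals try (constructor <;> linarith)
    all_goals try first | rfl | linarith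
    exact Or.inl trivial

/-! ### Feasibility of one greedy step. -/

theorem SurplusSpec.feasible {α β S : ℝ} (hα : 0 ≤ α) {i : Fin 2} {s E : Fin 2 → ℝ} {u : Control}
    (hs : ∀ k, 0 ≤ s k) (h : SurplusSpec α β S i s E u) : Feasible α β S s E u where
  w_nonneg := by simp [h.w_eq]
  c_nonneg := h.c_nonneg
  d_nonneg := by simp [h.d_eq]
  x_nonneg := (forall_iff_self_other i).2 ⟨h.x_nonneg, h.x_other.ge⟩
  charge_or_discharge := by simp [h.d_eq]
  one_way := by rw [apply_zero_mul_apply_one i, h.x_other, mul_zero]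
  discharge_le := by simpa [h.d_eq] using hs
  next_nonneg k := by
    have := mul_nonneg hα (h.c_nonneg k)
    simp only [nextStorage, h.d_eq, Pi.zero_apply]
    linarith [hs k]
  next_le k := by
    simpa [nextStorage, h.d_eq] using h.next_le k
  neutral := by
    have h₁ := h.neutral
    have h₂ := h.neutral_other
    simp only [forall_iff_self_other i, h.w_eq, h.d_eq, h.x_other, other_other, Pi.zero_apply]
    constructor <;> linarith

theorem DeficitSpec.feasible {α β S : ℝ} {i : Fin 2} {s E : Fin 2 → ℝ} {u : Control}
    (hs : ∀ k, s k ≤ S) (h : DeficitSpec α β i s E u) : Feasible α β S s E u where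
  w_nonneg := (forall_iff_self_other i).2 ⟨h.w_self.ge, h.w_other⟩
  c_nonneg := by simp [h.c_eq]
  d_nonneg := h.d_nonneg
  x_nonneg := (forall_iff_self_other i).2 ⟨h.x_nonneg, h.x_other.ge⟩
  charge_or_discharge := by simp [h.c_eq]
  one_way := by rw [apply_zero_mul_apply_one i, h.x_other, mul_zero]
  discharge_le := h.d_le
  next_nonneg k := by
    simpa [nextStorage, h.c_eq] using h.d_le k
  next_le k := by
    simp only [nextStorage, h.c_eq, Pi.zero_apply]
    linarith [hs k, h.d_nonneg k]
  neutral := by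
    have h₁ := h.neutral
    have h₂ := h.neutral_other
    simp only [forall_iff_self_other i, h.w_self, h.c_eq, h.x_other, other_other, Pi.zero_apply]
    constructor <;> linarith

theorem transferFirstRule_feasible {α β S : ℝ} (hα : 0 ≤ α) (hβ : 0 ≤ β) {i : Fin 2}
    {s E : Fin 2 → ℝ} (hs₀ : ∀ k, 0 ≤ s k) (hs : ∀ k, s k ≤ S) (hE : 0 ≤ E i)
    (hE' : E (other i) ≤ 0) :
    Feasible α β S s E (transferFirstRule α β S i s E) := by
  rcases le_or_gt 0 (β * E i + E (other i)) with hD | hD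
  · exact (transferFirstRule_spec_of_surplus hα hβ hs hE hE' hD).feasible hα hs₀
  · exact (transferFirstRule_spec_of_deficit S hα hβ hs₀ hE hE' hD).feasible hs

/-! ### The potential and the one-step comparison. -/

/-- The energy that the storages can deliver to the BS `other i`. -/
def deliverable (α β : ℝ) (i : Fin 2) (s : Fin 2 → ℝ) : ℝ :=
  α * (β * s i + s (other i))

theorem deliverable_nonneg {α β : ℝ} (hα : 0 ≤ α) (hβ : 0 ≤ β) (i : Fin 2) {s : Fin 2 → ℝ}
    (hs : ∀ k, 0 ≤ s k) : 0 ≤ deliverable α β i s :=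
  mul_nonneg hα (add_nonneg (mul_nonneg hβ (hs _)) (hs _))

theorem deliverable_mono {α β : ℝ} (hα : 0 ≤ α) (hβ : 0 ≤ β) (i : Fin 2) {s s' : Fin 2 → ℝ}
    (hs : ∀ k, s k ≤ s' k) : deliverable α β i s ≤ deliverable α β i s' := by
  unfold deliverable
  have h₁ := hs i
  have h₂ := hs (other i)
  gcongr

/-- Charged energy pays the factor `α` on entry and again on exit, discharged energy only on exit.
-/
theorem deliverable_nextStorage (α β : ℝ) (i : Fin 2) (s : Fin 2 → ℝ) (u : Control) :
    deliverable α β i (nextStorage α s u) = deliverable α β i s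
      + α ^ 2 * (β * u.c i + u.c (other i)) - α * (β * u.d i + u.d (other i)) := by
  simp only [deliverable, nextStorage]
  ring

/-- Any feasible control gains at most the surplus plus the grid energy. -/
theorem Feasible.charge_le {α β S : ℝ} (hβ₀ : 0 ≤ β) (hβ₁ : β ≤ 1) (i : Fin 2)
    {s E : Fin 2 → ℝ} {u : Control} (h : Feasible α β S s E u) :
    β * u.c i + u.c (other i) ≤
      β * E i + E (other i) + (u.w 0 + u.w 1) + α * (β * u.d i + u.d (other i)) := by
  -- With weight `β` on BS `i`, the transfer out of `i` cancels. The opposite transfer and grid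
  -- energy bought at `i` only lose, by the factors `1 - β * β` and `1 - β`.
  have h₁ := mul_nonneg hβ₀ (h.neutral i)
  have h₂ := h.neutral (other i)
  rw [other_other] at h₂
  have h₃ : 0 ≤ (1 - β) * u.w i := mul_nonneg (by linarith) (h.w_nonneg i)
  have h₄ : 0 ≤ (1 - β * β) * u.x (other i) :=
    mul_nonneg (by nlinarith) (h.x_nonneg _)
  rw [apply_zero_add_apply_one i]
  linarith

/-- One step of the comparison of `transferFirstRule`, at storage levels `s`, with a feasible
control `u'` at storage levels `s'`, where `W` and `W'` are the amounts of grid energy drawn so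
far. -/
theorem transferFirstRule_step {α β S : ℝ} (hα₀ : 0 ≤ α) (hα₁ : α ≤ 1) (hβ₀ : 0 ≤ β) (hβ₁ : β ≤ 1)
    {i : Fin 2} {s s' E : Fin 2 → ℝ} {u u' : Control} {W W' : ℝ}
    (hu : u = transferFirstRule α β S i s E)
    (hs₀ : ∀ k, 0 ≤ s k) (hs : ∀ k, s k ≤ S) (hE : 0 ≤ E i) (hE' : E (other i) ≤ 0)
    (h : Feasible α β S s' E u') (hW : W ≤ W')
    (hV : W + deliverable α β i s' ≤ W' + deliverable α β i s) :
    W + (u.w 0 + u.w 1) ≤ W' + (u'.w 0 + u'.w 1) ∧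
      W + (u.w 0 + u.w 1) + deliverable α β i (nextStorage α s' u') ≤
        W' + (u'.w 0 + u'.w 1) + deliverable α β i (nextStorage α s u) := by
  have hcharge := h.charge_le hβ₀ hβ₁ i
  have hC : 0 ≤ β * u'.c i + u'.c (other i) :=
    add_nonneg (mul_nonneg hβ₀ (h.c_nonneg _)) (h.c_nonneg _)
  have hG : 0 ≤ α * (β * u'.d i + u'.d (other i)) :=
    mul_nonneg hα₀ (add_nonneg (mul_nonneg hβ₀ (h.d_nonneg _)) (h.d_nonneg _))
  have hw : 0 ≤ u'.w 0 + u'.w 1 := add_nonneg (h.w_nonneg _) (h.w_nonneg _)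
  have hα₂ : α ^ 2 ≤ 1 := pow_le_one₀ hα₀ hα₁
  have hα₃ : 0 ≤ α ^ 2 := sq_nonneg α
  have hV' := deliverable_nextStorage α β i s' u'
  have hVu := deliverable_nextStorage α β i s u
  have hfull := deliverable_mono hα₀ hβ₀ i h.next_le
  have hnn := deliverable_nonneg hα₀ hβ₀ i h.next_nonneg
  rcases le_or_gt 0 (β * E i + E (other i)) with hD | hD
  · have spec := transferFirstRule_spec_of_surplus hα₀ hβ₀ hs hE hE' hD
    rw [← hu] at spec
    have hu0 : u.w 0 + u.w 1 = 0 := by simp [spec.w_eq]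
    refine ⟨by linarith, ?_⟩
    rw [hu0]
    rcases spec.efficient with he | he | he
    · rw [he, spec.d_eq] at hVu
      simp only [Pi.zero_apply] at hVu
      generalize α * (β * u'.d i + u'.d (other i)) = G at *
      have h₁ := mul_le_mul_of_nonneg_left hcharge hα₃
      have h₂ := mul_le_mul_of_nonneg_right hα₂ hG
      have h₃ := mul_le_mul_of_nonneg_right hα₂ hw
      linarith
    -- With both storages full, the greedy potential is the largest possible, so `hfull` suffices.
    · have : nextStorage α s u = fun _ => S := by
        funext k
        simpa [nextStorage, spec.d_eq] using he k
      rw [this]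
      linarith
    · simp only [deliverable, he, zero_mul]
      linarith
  · have spec := transferFirstRule_spec_of_deficit S hα₀ hβ₀ hs₀ hE hE' hD
    rw [← hu] at spec
    have hu0 : u.w 0 + u.w 1 = u.w (other i) := by
      rw [apply_zero_add_apply_one i, spec.w_self, zero_add]
    have heff := spec.efficient
    have hnext : W + (u.w 0 + u.w 1) + deliverable α β i (nextStorage α s' u') ≤
        W' + (u'.w 0 + u'.w 1) + deliverable α β i (nextStorage α s u) := by
      rw [spec.c_eq] at hVu
      simp only [Pi.zero_apply] at hVu
      have h₁ := mul_le_mul_of_nonneg_right hα₂ hC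
      linarith
    refine ⟨?_, hnext⟩
    -- If grid energy is drawn, the greedy potential is zero, and `hnext` with `hnn` gives the bound
    -- on grid energy.
    have hzero : u.w (other i) = 0 ∨ deliverable α β i (nextStorage α s u) = 0 := by
      refine spec.empty.imp_right fun he => ?_
      rcases he with he | ⟨he, he' | he'⟩
      · simp [deliverable, he]
      · simp [deliverable, nextStorage, spec.c_eq, he, he']
      · simp [deliverable, nextStorage, spec.c_eq, he, he']
    rcases hzero with he | he <;> linarith

/-! ### Comparison along a whole profile. -/

theorem storage_modifiedGreedy (α β S : ℝ) (i : Fin 2) (e : Profile) (t : ℕ) :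
    storage α (modifiedGreedy α β S i) e t = greedyStorage α β S i e t := by
  induction t with
  | zero => rfl
  | succ t ih => simp only [storage, greedyStorage, ih, modifiedGreedy]

theorem greedyStorage_mem {α β S : ℝ} (hα : 0 ≤ α) (hβ : 0 ≤ β) (hS : 0 ≤ S) {i : Fin 2}
    {N : ℕ} {e : Profile} (he : ∀ t < N, 0 ≤ e t i ∧ e t (other i) ≤ 0) {t : ℕ} (ht : t ≤ N) :
    (∀ k, 0 ≤ greedyStorage α β S i e t k) ∧ ∀ k, greedyStorage α β S i e t k ≤ S := by
  induction t with
  | zero => exact ⟨fun _ => le_rfl, fun _ => hS⟩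
  | succ t ih =>
    obtain ⟨h₁, h₂⟩ := ih (by omega)
    have h := transferFirstRule_feasible hα hβ h₁ h₂ (he t (by omega)).1 (he t (by omega)).2
    exact ⟨h.next_nonneg, h.next_le⟩

/-- The modified greedy policy draws the least grid energy along every profile. -/
theorem modifiedGreedy_sum_le {α β S : ℝ} (hα₀ : 0 ≤ α) (hα₁ : α ≤ 1) (hβ₀ : 0 ≤ β) (hβ₁ : β ≤ 1)
    (hS : 0 ≤ S) {i : Fin 2} {N : ℕ} {e : Profile}
    (he : ∀ t < N, 0 ≤ e t i ∧ e t (other i) ≤ 0) {π : Policy}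
    (hπ : ∀ t < N, Feasible α β S (storage α π e t) (e t) (π t e)) :
    ∑ t ∈ Finset.range N, ((modifiedGreedy α β S i t e).w 0 + (modifiedGreedy α β S i t e).w 1) ≤
      ∑ t ∈ Finset.range N, ((π t e).w 0 + (π t e).w 1) := by
  -- The grid energy bound alone is not inductive; the potential must be carried along.
  suffices h : ∀ n ≤ N,
      ∑ t ∈ Finset.range n,
          ((modifiedGreedy α β S i t e).w 0 + (modifiedGreedy α β S i t e).w 1) ≤
        ∑ t ∈ Finset.range n, ((π t e).w 0 + (π t e).w 1) ∧
      ∑ t ∈ Finset.range n,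
          ((modifiedGreedy α β S i t e).w 0 + (modifiedGreedy α β S i t e).w 1) +
          deliverable α β i (storage α π e n) ≤
        ∑ t ∈ Finset.range n, ((π t e).w 0 + (π t e).w 1) +
          deliverable α β i (greedyStorage α β S i e n) from (h N le_rfl).1
  intro n hn
  induction n with
  | zero => simp [storage, greedyStorage]
  | succ n ih =>
    obtain ⟨h₁, h₂⟩ := ih (by omega)
    obtain ⟨h₃, h₄⟩ := greedyStorage_mem (β := β) hα₀ hβ₀ hS he (t := n) (by omega)
    simp only [Finset.sum_range_succ]
    exact transferFirstRule_step hα₀ hα₁ hβ₀ hβ₁ rfl h₃ h₄ (he n hn).1 (he n hn).2 (hπ n hn) h₁ h₂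

/-! ### Causality and measurability. -/

theorem greedyStorage_congr (α β S : ℝ) (i : Fin 2) {e e' : Profile} {t : ℕ}
    (h : ∀ k < t, e k = e' k) : greedyStorage α β S i e t = greedyStorage α β S i e' t := by
  induction t with
  | zero => rfl
  | succ t ih =>
    simp only [greedyStorage, ih fun k hk => h k (by omega), h t (by omega)]

/-- Measurability of all components of a family of controls. -/
structure MeasurableControl {Ω : Type*} [MeasurableSpace Ω] (u : Ω → Control) : Prop where
  w : ∀ k, Measurable fun ω => (u ω).w k
  c : ∀ k, Measurable fun ω => (u ω).c k
  d : ∀ k, Measurable fun ω => (u ω).d k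
  x : ∀ k, Measurable fun ω => (u ω).x k

theorem MeasurableControl.ite {Ω : Type*} [MeasurableSpace Ω] {p : Ω → Prop}
    [DecidablePred p] {u v : Ω → Control}
    (hp : MeasurableSet {ω | p ω}) (hu : MeasurableControl u) (hv : MeasurableControl v) :
    MeasurableControl fun ω => if p ω then u ω else v ω where
  w k := by simpa only [apply_ite Control.w, ite_apply] using (hu.w k).ite hp (hv.w k)
  c k := by simpa only [apply_ite Control.c, ite_apply] using (hu.c k).ite hp (hv.c k)
  d k := by simpa only [apply_ite Control.d, ite_apply] using (hu.d k).ite hp (hv.d k)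
  x k := by simpa only [apply_ite Control.x, ite_apply] using (hu.x k).ite hp (hv.x k)

theorem measurable_single_apply {Ω : Type*} [MeasurableSpace Ω] (i k : Fin 2) {f : Ω → ℝ}
    (hf : Measurable f) : Measurable fun ω => (Pi.single i (f ω) : Fin 2 → ℝ) k := by
  rcases eq_or_ne k i with rfl | h
  · simpa only [Pi.single_eq_same] using hf
  · simp only [Pi.single_eq_of_ne h, measurable_const]

theorem measurable_update_apply {Ω : Type*} [MeasurableSpace Ω] (i : Fin 2) {f : Ω → ℝ}
    {g : Ω → Fin 2 → ℝ} (hf : Measurable f) (hg : ∀ k, Measurable fun ω => g ω k) (k : Fin 2) :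
    Measurable fun ω => Function.update (g ω) i (f ω) k := by
  rcases eq_or_ne k i with rfl | h
  · simpa only [Function.update_self] using hf
  · simpa only [Function.update_of_ne h] using hg k

theorem measurableControl_surplusRule {Ω : Type*} [MeasurableSpace Ω] (α β S : ℝ)
    {s E : Ω → Fin 2 → ℝ} (hs : ∀ k, Measurable fun ω => s ω k)
    (hE : ∀ k, Measurable fun ω => E ω k) :
    MeasurableControl fun ω => surplusRule α β S (s ω) (E ω) := by
  have hc (k) : Measurable fun ω => min ((S - s ω k) / α) (E ω k) :=
    ((measurable_const.sub (hs k)).div_const α).min (hE k)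
  have hs' (k) : Measurable fun ω => s ω k + α * min ((S - s ω k) / α) (E ω k) :=
    (hs k).add ((hc k).const_mul α)
  have hx (k) : Measurable fun ω =>
      if β = 0 then 0 else E ω k - min ((S - s ω k) / α) (E ω k) := by
    split_ifs
    · exact measurable_const
    · exact (hE k).sub (hc k)
  have hshare (k) : MeasurableControl fun ω => (
      { w := 0
        c := (fun k => min ((S - s ω k) / α) (E ω k)) + Pi.single (other k)
          (min (β * if β = 0 then 0 else E ω k - min ((S - s ω k) / α) (E ω k))
            ((S - (s ω (other k) + α * min ((S - s ω (other k)) / α) (E ω (other k)))) / α))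
        d := 0
        x := Pi.single k (if β = 0 then 0 else E ω k - min ((S - s ω k) / α) (E ω k)) } :
      Control) := by
    refine ⟨fun _ => measurable_const, fun l => ?_, fun _ => measurable_const, fun l => ?_⟩
    · exact (hc l).add (measurable_single_apply _ _ (((hx k).const_mul β).min
        ((measurable_const.sub (hs' _)).div_const α)))
    · exact measurable_single_apply _ _ (hx k)
  simp only [surplusRule]
  have hset (k l) : MeasurableSet {ω | s ω k + α * min ((S - s ω k) / α) (E ω k) = S ∧
      s ω l + α * min ((S - s ω l) / α) (E ω l) < S} :=
    (measurableSet_eq_fun (hs' k) measurable_const).inter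
      (measurableSet_lt (hs' l) measurable_const)
  refine .ite (hset 0 1) (hshare 0) (.ite (hset 1 0) (hshare 1) ?_)
  exact ⟨fun _ => measurable_const, hc, fun _ => measurable_const, fun _ => measurable_const⟩

theorem measurableControl_transferFirstRule {Ω : Type*} [MeasurableSpace Ω] (α β S : ℝ)
    (i : Fin 2) {s E : Ω → Fin 2 → ℝ} (hs : ∀ k, Measurable fun ω => s ω k)
    (hE : ∀ k, Measurable fun ω => E ω k) :
    MeasurableControl fun ω => transferFirstRule α β S i (s ω) (E ω) := by
  have habs {f : Ω → ℝ} (hf : Measurable f) : Measurable fun ω => |f ω| := hf.abs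
  have hx : Measurable fun ω => min (E ω i) (|E ω (other i)| / β) :=
    (hE i).min ((habs (hE _)).div_const β)
  have hE₁ := (hE (other i)).add (hx.const_mul β)
  have hd' := ((habs hE₁).div_const α).min (hs (other i))
  have hE₂ := hE₁.add (hd'.const_mul α)
  have hd := ((habs hE₂).div_const (α * β)).min (hs i)
  have hE₃ := hE₂.add (hd.const_mul (α * β))
  have hu := measurableControl_surplusRule α β S hs
    (measurable_update_apply (other i) hE₁ (measurable_update_apply i ((hE i).sub hx) hE))
  simp only [transferFirstRule]
  refine .ite (measurableSet_eq_fun hE₁ measurable_const) ?_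
    (.ite (measurableSet_eq_fun hE₂ measurable_const) ?_ ?_)
  · exact ⟨hu.w, hu.c, hu.d, fun k => (hu.x k).add (measurable_single_apply _ _ hx)⟩
  · exact ⟨fun _ => measurable_const, fun _ => measurable_const,
      fun k => measurable_single_apply _ _ hd', fun k => measurable_single_apply _ _ hx⟩
  · exact ⟨fun k => measurable_single_apply _ _
        ((habs hE₃).ite (measurableSet_lt hE₃ measurable_const) measurable_const),
      fun _ => measurable_const,
      fun k => (measurable_single_apply _ _ hd').add (measurable_single_apply _ _ hd),
      fun k => measurable_single_apply _ _ (hx.add (hd.const_mul α))⟩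

theorem measurable_profile_apply (t : ℕ) (k : Fin 2) : Measurable fun e : Profile => e t k :=
  (measurable_pi_apply k).comp (measurable_pi_apply t)

theorem measurable_greedyStorage (α β S : ℝ) (i : Fin 2) (t : ℕ) (k : Fin 2) :
    Measurable fun e => greedyStorage α β S i e t k := by
  induction t generalizing k with
  | zero => exact measurable_const
  | succ t ih =>
    have h := measurableControl_transferFirstRule α β S i ih (measurable_profile_apply t)
    exact ((ih k).add ((h.c k).const_mul α)).sub (h.d k)

theorem measurableControl_modifiedGreedy (α β S : ℝ) (i : Fin 2) (t : ℕ) :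
    MeasurableControl (modifiedGreedy α β S i t) :=
  measurableControl_transferFirstRule α β S i (measurable_greedyStorage α β S i t)
    (measurable_profile_apply t)

/-! ### Admissibility and optimality. -/

theorem admissible_modifiedGreedy {α β S : ℝ} (hα : 0 ≤ α) (hβ : 0 ≤ β) (hS : 0 ≤ S) (i : Fin 2)
    {N : ℕ} {F : Measure Profile} (hF : ∀ᵐ e ∂F, ∀ t < N, 0 ≤ e t i ∧ e t (other i) ≤ 0) :
    Admissible α β S N F (modifiedGreedy α β S i) where
  measurable_w t _ := (measurableControl_modifiedGreedy α β S i t).w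
  measurable_c t _ := (measurableControl_modifiedGreedy α β S i t).c
  measurable_d t _ := (measurableControl_modifiedGreedy α β S i t).d
  measurable_x t _ := (measurableControl_modifiedGreedy α β S i t).x
  causal t _ e e' h := by
    simp only [modifiedGreedy, greedyStorage_congr α β S i fun k hk => h k hk.le, h t le_rfl]
  feasible := by
    filter_upwards [hF] with e he t ht
    obtain ⟨h₁, h₂⟩ := greedyStorage_mem (β := β) hα hβ hS he ht.le
    rw [storage_modifiedGreedy]
    exact transferFirstRule_feasible hα hβ h₁ h₂ (he t ht).1 (he t ht).2

theorem isOptimal_modifiedGreedy {α β S : ℝ} (hα₀ : 0 ≤ α) (hα₁ : α ≤ 1) (hβ₀ : 0 ≤ β)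
    (hβ₁ : β ≤ 1) (hS : 0 ≤ S) (i : Fin 2) {N : ℕ} {F : Measure Profile}
    (hF : ∀ᵐ e ∂F, ∀ t < N, 0 ≤ e t i ∧ e t (other i) ≤ 0) :
    IsOptimal α β S N F (modifiedGreedy α β S i) := by
  -- The comparison holds almost surely profile by profile, so no integrability is needed and
  -- infinite costs are allowed.
  refine ⟨admissible_modifiedGreedy hα₀ hβ₀ hS i hF, fun π hπ => lintegral_mono_ae ?_⟩
  filter_upwards [hF, hπ.feasible] with e he hfeas
  have := modifiedGreedy_sum_le hα₀ hα₁ hβ₀ hβ₁ hS he hfeas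
  gcongr

end EnergyCoop

theorem mainTheorem4 (α β S : ℝ) (hα₀ : 0 ≤ α) (hα₁ : α ≤ 1) (hβ₀ : 0 ≤ β) (hβ₁ : β ≤ 1)
    (hS : 0 ≤ S) (N : ℕ) (F : MeasureTheory.Measure EnergyCoop.Profile)
    [MeasureTheory.IsProbabilityMeasure F] :
    ((∀ᵐ e ∂F, ∀ t < N, 0 ≤ e t 0 ∧ e t 1 ≤ 0) →
      EnergyCoop.IsOptimal α β S N F (EnergyCoop.modifiedGreedy α β S 0)) ∧
    ((∀ᵐ e ∂F, ∀ t < N, 0 ≤ e t 1 ∧ e t 0 ≤ 0) →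
      EnergyCoop.IsOptimal α β S N F (EnergyCoop.modifiedGreedy α β S 1)) :=
  ⟨EnergyCoop.isOptimal_modifiedGreedy hα₀ hα₁ hβ₀ hβ₁ hS 0,
    EnergyCoop.isOptimal_modifiedGreedy hα₀ hα₁ hβ₀ hβ₁ hS 1⟩
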